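/- For a nonempty closed convex set $X\subseteq\mathbb{R}^d$ let $\Pi_X(v)=\arg\min_{z\in X}\|v-z\|_2^2$ be the Euclidean projection. Let $\mathbb{PP}_d=\mathrm{conv}\{e\in\{0,1\}^d:\|e\|_1\text{ even}\}$ be the parity polytope and $\mathbb{S}_d=\{x\in\mathbb{R}^d:\sum_i x_i=1,\ x_i\ge 0 \text{ for all } i\}$ the probability simplex. For $f\in\{0,1\}^d$ let $T_f:\mathbb{R}^d\to\mathbb{R}^d$ be given by $T_f(v)_i=1-v_i$ if $f_i=1$ and $T_f(v)_i=v_i$ if $f_i=0$. Consider the following algorithm with input $v\in\mathbb{R}^d$. Put $\hat v=\Pi_{[0,1]^d}(v)$, and let $f_i=1$ if $\hat v_i>\tfrac12$ and $f_i=0$ otherwise. If $\sum_i f_i$ is even, choose $i^\ast\in\arg\min_i|\tfrac12-\hat v_i|$ (ties are broken arbitrarily) and replace $f_{i^\ast}$ by $1-f_{i^\ast}$. If $\sum_i\Pi_{[0,1]^d}(T_f(v))_i\ge 1$, return $\hat v$; otherwise return $T_f(\Pi_{\mathbb{S}_d}(T_f(v)))$. Theorem. Let $v\in\mathbb{R}^d$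 be such that $\Pi_{[0,1]^d}(v)\notin\mathbb{PP}_d$, and let $f\in\{0,1\}^d$ be the vector calculated by the algorithm. Then $$\Pi_{\mathbb{PP}_d}(v)=T_f\bigl(\Pi_{\mathbb{S}_d}(T_f(v))\bigr),$$ and the algorithm returns $\Pi_{\mathbb{PP}_d}(v)$. -/

import Mathlib

namespace ParityPolytope

/-- `p` is a minimizer over `X` of the Euclidean distance to `v`. -/
def IsProj {d : ℕ} (X : Set (EuclideanSpace ℝ (Fin d))) (v p : EuclideanSpace ℝ (Fin d)) : Prop :=
  p ∈ X ∧ ∀ z ∈ X, ‖v - p‖ ^ 2 ≤ ‖v - z‖ ^ 2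

/-- Euclidean projection of `v` onto `X`, the argmin of `‖v - z‖ ^ 2` over `z ∈ X`. It is well
defined for nonempty closed convex `X`, see `existsUnique_isProj` and `isProj_iff`. -/
noncomputable def proj {d : ℕ} (X : Set (EuclideanSpace ℝ (Fin d)))
    (v : EuclideanSpace ℝ (Fin d)) : EuclideanSpace ℝ (Fin d) :=
  Classical.epsilon (IsProj X v)

/-- The unit cube `[0,1]^d`. -/
def cube (d : ℕ) : Set (EuclideanSpace ℝ (Fin d)) :=
  {x | ∀ i, 0 ≤ x i ∧ x i ≤ 1}

/-- The probability simplex: nonnegative vectors whose components sum to one. -/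
def simplex (d : ℕ) : Set (EuclideanSpace ℝ (Fin d)) :=
  {x | ∑ i, x i = 1 ∧ ∀ i, 0 ≤ x i}

/-- A binary vector viewed as a real vector. -/
noncomputable def binVec {d : ℕ} (b : Fin d → Fin 2) : EuclideanSpace ℝ (Fin d) :=
  WithLp.toLp 2 fun i => ((b i : ℕ) : ℝ)

/-- The weight (number of ones) of a binary vector. -/
def weight {d : ℕ} (b : Fin d → Fin 2) : ℕ := ∑ i, (b i : ℕ)

/-- The parity polytope: convex hull of the vertices of the unit cube of even weight. -/
def parityPolytope (d : ℕ) : Set (EuclideanSpace ℝ (Fin d)) :=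
  convexHull ℝ (binVec '' {b : Fin d → Fin 2 | Even (weight b)})

/-- The map `T_f`, replacing `v i` by `1 - v i` at those `i` where `f i = 1`. -/
noncomputable def flip {d : ℕ} (f : Fin d → Fin 2) (v : EuclideanSpace ℝ (Fin d)) :
    EuclideanSpace ℝ (Fin d) :=
  WithLp.toLp 2 fun i => if f i = 1 then 1 - v i else v i

/-- Componentwise thresholding at `1/2`. -/
noncomputable def threshold {d : ℕ} (x : EuclideanSpace ℝ (Fin d)) : Fin d → Fin 2 :=
  fun i => if x i > 1 / 2 then 1 else 0

/-- `f` is a binary vector that the algorithm may compute from the input `v`: threshold the box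
projection of `v` at `1/2`; if the result has even weight, flip its entry at an index `j` at which
the box projection is closest to `1/2` (any such `j` is allowed). -/
def IsFacetVector {d : ℕ} (v : EuclideanSpace ℝ (Fin d)) (f : Fin d → Fin 2) : Prop :=
  (Odd (weight (threshold (proj (cube d) v))) ∧ f = threshold (proj (cube d) v)) ∨
  (Even (weight (threshold (proj (cube d) v))) ∧
    ∃ j : Fin d, (∀ i, |1 / 2 - proj (cube d) v j| ≤ |1 / 2 - proj (cube d) v i|) ∧
      f = Function.update (threshold (proj (cube d) v)) j (1 - threshold (proj (cube d) v) j))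

open Classical in
/-- The output of the algorithm on input `v`, when `f` is the binary vector it has computed. -/
noncomputable def algorithmOutput {d : ℕ} (v : EuclideanSpace ℝ (Fin d)) (f : Fin d → Fin 2) :
    EuclideanSpace ℝ (Fin d) :=
  if 1 ≤ ∑ i, proj (cube d) (flip f v) i then proj (cube d) v
  else flip f (proj (simplex d) (flip f v))

/-- Projections onto nonempty closed convex sets exist and are unique. -/
theorem existsUnique_isProj {d : ℕ} {X : Set (EuclideanSpace ℝ (Fin d))} (hne : X.Nonempty)
    (hcl : IsClosed X) (hco : Convex ℝ X) (v : EuclideanSpace ℝ (Fin d)) :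
    ∃! p, IsProj X v p := by
  have key : ∀ p ∈ X, IsProj X v p → ∀ z ∈ X, inner ℝ (v - p) (z - p) ≤ 0 := by
    intro p hp h
    refine (norm_eq_iInf_iff_real_inner_le_zero hco hp).1 ?_
    have : Nonempty X := ⟨⟨p, hp⟩⟩
    refine le_antisymm (le_ciInf fun z => ?_)
      (ciInf_le (f := fun w : X => ‖v - w‖) ⟨0, ?_⟩ ⟨p, hp⟩)
    · exact le_of_sq_le_sq (h.2 z z.2) (norm_nonneg _)
    · rintro _ ⟨w, rfl⟩
      exact norm_nonneg _
  obtain ⟨p, hp, h⟩ := exists_norm_eq_iInf_of_complete_convex hne hcl.isComplete hco v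
  have hpP : IsProj X v p := by
    refine ⟨hp, fun z hz => ?_⟩
    have : ‖v - p‖ ≤ ‖v - z‖ := by
      rw [h]
      refine ciInf_le (f := fun w : X => ‖v - w‖) ⟨0, ?_⟩ ⟨z, hz⟩
      rintro _ ⟨w, rfl⟩
      exact norm_nonneg _
    gcongr
  refine ⟨p, hpP, fun q hq => ?_⟩
  have h1 := key p hp hpP q hq.1
  have h2 := key q hq.1 hq p hp
  have h3 : inner ℝ (q - p) (q - p) = inner ℝ (v - p) (q - p) + inner ℝ (v - q) (p - q) := by
    rw [← neg_sub q p, inner_neg_right, ← sub_eq_add_neg, ← inner_sub_left]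
    congr 1
    abel
  have h4 : inner ℝ (q - p) (q - p) = 0 :=
    le_antisymm (h3 ▸ add_nonpos h1 h2) real_inner_self_nonneg
  exact sub_eq_zero.1 (inner_self_eq_zero.1 h4)

theorem isProj_iff {d : ℕ} {X : Set (EuclideanSpace ℝ (Fin d))} (hne : X.Nonempty)
    (hcl : IsClosed X) (hco : Convex ℝ X) (v p : EuclideanSpace ℝ (Fin d)) :
    IsProj X v p ↔ proj X v = p := by
  have hu := existsUnique_isProj hne hcl hco v
  have hs : IsProj X v (proj X v) := Classical.epsilon_spec hu.exists
  exact ⟨fun h => hu.unique hs h, fun h => h ▸ hs⟩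

/-- The cube, the parity polytope and (in positive dimension) the simplex are nonempty, closed and
convex, so projection onto each of them is well defined. -/
theorem cube_wellDefined (d : ℕ) :
    (cube d).Nonempty ∧ IsClosed (cube d) ∧ Convex ℝ (cube d) := by
  refine ⟨⟨0, fun i => by simp⟩, ?_, ?_⟩
  · simp only [cube, Set.ofPred_forall]
    refine isClosed_iInter fun i => IsClosed.and ?_ ?_
    · exact isClosed_le (by fun_prop) (by fun_prop)
    · exact isClosed_le (by fun_prop) (by fun_prop)
  · intro x hx y hy a b ha hb hab i
    have hxi := hx i
    have hyi := hy i
    simp only [PiLp.add_apply, PiLp.smul_apply, smul_eq_mul]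
    constructor <;> nlinarith

theorem simplex_wellDefined (d : ℕ) (hd : 0 < d) :
    (simplex d).Nonempty ∧ IsClosed (simplex d) ∧ Convex ℝ (simplex d) := by
  refine ⟨⟨EuclideanSpace.single ⟨0, hd⟩ 1, ?_, fun i => ?_⟩, ?_, ?_⟩
  · simp
  · simp only [PiLp.single_apply]
    split_ifs <;> norm_num
  · refine IsClosed.and (isClosed_eq (by fun_prop) (by fun_prop)) ?_
    simp only [Set.ofPred_forall]
    exact isClosed_iInter fun i => isClosed_le (by fun_prop) (by fun_prop)
  · intro x hx y hy a b ha hb hab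
    refine ⟨?_, fun i => ?_⟩
    · simp only [PiLp.add_apply, PiLp.smul_apply, smul_eq_mul, Finset.sum_add_distrib,
        ← Finset.mul_sum, hx.1, hy.1]
      linarith
    · have hxi := hx.2 i
      have hyi := hy.2 i
      simp only [PiLp.add_apply, PiLp.smul_apply, smul_eq_mul]
      positivity

theorem parityPolytope_wellDefined (d : ℕ) :
    (parityPolytope d).Nonempty ∧ IsClosed (parityPolytope d) ∧
      Convex ℝ (parityPolytope d) := by
  refine ⟨⟨binVec 0, subset_convexHull ℝ _ ⟨0, by simp [weight], rfl⟩⟩, ?_, convex_convexHull ℝ _⟩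
  exact ((Set.toFinite _).isCompact_convexHull ℝ).isClosed

end ParityPolytope

/-!
Up to the cube, the parity polytope is cut out by the inequalities `1 ≤ ∑ i, flip f x i` over
odd-weight `f`: a linear functional is maximized over the cube at the vertex given by the signs of
its coefficients, and if that vertex is odd, toggling the coordinate with the smallest coefficient
costs no more than the inequality of that vertex gives. Two odd-weight vectors differ in at least
two coordinates, so the inequality of `f` implies all others as soon as no two coordinates of
`flip f x` have sum above one, which thresholding ensures when `x` is the cube projection of `v`.

After the isometry `flip f`, only one inequality is left. If the cube projection of `w = flip f v`
violates it, then the segment from that projection to any point of the cube satisfying it meets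
the simplex at a point no farther from `w`. So the projection of `w` onto the simplex is the nearest
point to `w` in the truncated cube, and the simplex lies in the flipped parity polytope.
-/

namespace ParityPolytope

variable {d : ℕ}

section Projection

variable {X Y : Set (EuclideanSpace ℝ (Fin d))} {v p : EuclideanSpace ℝ (Fin d)}

theorem isProj_proj (hX : X.Nonempty ∧ IsClosed X ∧ Convex ℝ X) (v : EuclideanSpace ℝ (Fin d)) :
    IsProj X v (proj X v) :=
  (isProj_iff hX.1 hX.2.1 hX.2.2 v _).2 rfl

theorem IsProj.proj_eq (h : IsProj X v p) (hX : X.Nonempty ∧ IsClosed X ∧ Convex ℝ X) :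
    proj X v = p :=
  (isProj_iff hX.1 hX.2.1 hX.2.2 v p).1 h

theorem IsProj.mono (h : IsProj X v p) (hYX : Y ⊆ X) (hp : p ∈ Y) : IsProj Y v p :=
  ⟨hp, fun z hz => h.2 z (hYX hz)⟩

end Projection

section Flip

variable (f : Fin d → Fin 2)

theorem flip_apply (v : EuclideanSpace ℝ (Fin d)) (i : Fin d) :
    flip f v i = if f i = 1 then 1 - v i else v i := rfl

theorem flip_flip (v : EuclideanSpace ℝ (Fin d)) : flip f (flip f v) = v := by
  ext i
  simp only [flip_apply]
  split_ifs <;> ring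

theorem norm_flip_sub (v z : EuclideanSpace ℝ (Fin d)) : ‖flip f v - z‖ = ‖v - flip f z‖ := by
  simp only [EuclideanSpace.norm_eq, PiLp.sub_apply, flip_apply, Real.norm_eq_abs, sq_abs]
  congr! 2 with i
  split_ifs <;> ring

theorem flip_convexCombo (x y : EuclideanSpace ℝ (Fin d)) {a b : ℝ} (hab : a + b = 1) :
    flip f (a • x + b • y) = a • flip f x + b • flip f y := by
  ext i
  simp only [flip_apply, PiLp.add_apply, PiLp.smul_apply, smul_eq_mul]
  split_ifs
  · linear_combination -hab
  · rfl

theorem convex_preimage_flip {X : Set (EuclideanSpace ℝ (Fin d))} (hX : Convex ℝ X) :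
    Convex ℝ (flip f ⁻¹' X) := by
  intro x hx y hy a b ha hb hab
  rw [Set.mem_preimage, flip_convexCombo f x y hab]
  exact hX hx hy ha hb hab

theorem flip_mem_cube {x : EuclideanSpace ℝ (Fin d)} (hx : x ∈ cube d) : flip f x ∈ cube d := by
  intro i
  obtain ⟨h0, h1⟩ := hx i
  rw [flip_apply]
  split_ifs <;> constructor <;> linarith

theorem preimage_flip_cube : flip f ⁻¹' cube d = cube d :=
  Set.Subset.antisymm (fun x hx => flip_flip f x ▸ flip_mem_cube f hx) fun _ => flip_mem_cube f

theorem IsProj.preimage_flip {X : Set (EuclideanSpace ℝ (Fin d))} {v p : EuclideanSpace ℝ (Fin d)}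
    (h : IsProj X v p) : IsProj (flip f ⁻¹' X) (flip f v) (flip f p) := by
  refine ⟨by rw [Set.mem_preimage, flip_flip]; exact h.1, fun z hz => ?_⟩
  rw [norm_flip_sub, norm_flip_sub, flip_flip]
  exact h.2 _ hz

theorem proj_cube_flip (v : EuclideanSpace ℝ (Fin d)) :
    proj (cube d) (flip f v) = flip f (proj (cube d) v) := by
  have h := (isProj_proj (cube_wellDefined d) v).preimage_flip f
  rw [preimage_flip_cube] at h
  exact h.proj_eq (cube_wellDefined d)

variable {f}

theorem flip_apply_of_eq {b : Fin d → Fin 2} {i : Fin d} (h : b i = f i)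
    (v : EuclideanSpace ℝ (Fin d)) : flip b v i = flip f v i := by
  rw [flip_apply, flip_apply, h]

theorem flip_apply_of_ne {b : Fin d → Fin 2} {i : Fin d} (h : b i ≠ f i)
    (v : EuclideanSpace ℝ (Fin d)) : flip b v i = 1 - flip f v i := by
  rw [flip_apply, flip_apply]
  generalize b i = s at h
  generalize f i = t at h
  fin_cases s <;> fin_cases t <;> simp_all

end Flip

section BinaryVector

theorem binVec_apply (b : Fin d → Fin 2) (i : Fin d) : binVec b i = ((b i : ℕ) : ℝ) := rfl

theorem binVec_mem_cube (b : Fin d → Fin 2) : binVec b ∈ cube d := fun i =>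
  ⟨Nat.cast_nonneg _, Nat.cast_le_one.2 (Nat.le_of_lt_succ (b i).isLt)⟩

theorem flip_binVec_apply_of_ne {b f : Fin d → Fin 2} {i : Fin d} (h : b i ≠ f i) :
    flip f (binVec b) i = 1 := by
  rw [flip_apply, binVec_apply]
  generalize b i = s at h
  generalize f i = t at h
  fin_cases s <;> fin_cases t <;> simp_all

theorem weight_update_add (b : Fin d → Fin 2) (k : Fin d) (a : Fin 2) :
    weight (Function.update b k a) + (b k : ℕ) = weight b + a := by
  have h : ∀ i, (Function.update b k a i : ℕ) = Function.update (fun i => (b i : ℕ)) k a i :=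
    Function.apply_update (fun _ => Fin.val) b k a
  simp only [weight, h, Finset.sum_update_of_mem (Finset.mem_univ k),
    ← Finset.add_sum_erase _ _ (Finset.mem_univ k), Finset.sdiff_singleton_eq_erase]
  ring

theorem even_weight_update (b : Fin d → Fin 2) (k : Fin d) :
    Even (weight (Function.update b k (1 - b k))) ↔ Odd (weight b) := by
  have h := congrArg Even (weight_update_add b k (1 - b k))
  have hk : Even ((1 - b k : Fin 2) : ℕ) ↔ ¬Even (b k : ℕ) := by
    generalize b k = s
    revert s
    decide
  rw [Nat.even_add, Nat.even_add, hk] at h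
  rw [← Nat.not_even_iff_odd]
  tauto

theorem binVec_update (b : Fin d → Fin 2) (k : Fin d) :
    binVec (Function.update b k (1 - b k)) =
      binVec b + EuclideanSpace.single k (1 - 2 * binVec b k) := by
  ext i
  rcases eq_or_ne i k with rfl | hi
  · simp only [binVec_apply, PiLp.add_apply, PiLp.single_apply, Function.update_self, if_true]
    generalize b i = s
    fin_cases s <;> norm_num
  · simp [binVec_apply, hi]

theorem exists_two_ne_of_even_iff {b f : Fin d → Fin 2}
    (hparity : Even (weight b) ↔ Even (weight f)) (h : b ≠ f) :
    ∃ i k, i ≠ k ∧ b i ≠ f i ∧ b k ≠ f k := by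
  obtain ⟨i, hi⟩ := Function.ne_iff.1 h
  by_contra! hcon
  have hb : b = Function.update f i (1 - f i) := by
    refine (Function.update_eq_iff.2 ⟨?_, fun k hk => (hcon i k hk.symm hi).symm⟩).symm
    generalize b i = s at hi
    generalize f i = t at hi
    revert hi s t
    decide
  rw [hb, even_weight_update, ← Nat.not_even_iff_odd] at hparity
  tauto

theorem pos_of_odd_weight {f : Fin d → Fin 2} (hf : Odd (weight f)) : 0 < d := by
  rcases Nat.eq_zero_or_pos d with rfl | h
  · simp [weight] at hf
  · exact h

end BinaryVector

section TruncatedCube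

/-- The cube with the corner below the standard simplex cut off. Its images under the maps
`flip f`, with `f` of odd weight, are the sets given by the facet inequalities of the parity
polytope. -/
def truncatedCube (d : ℕ) : Set (EuclideanSpace ℝ (Fin d)) :=
  {x | x ∈ cube d ∧ 1 ≤ ∑ i, x i}

theorem convex_truncatedCube (d : ℕ) : Convex ℝ (truncatedCube d) := by
  have hlin : IsLinearMap ℝ fun x : EuclideanSpace ℝ (Fin d) => ∑ i, x i :=
    ⟨fun x y => by simp only [PiLp.add_apply, Finset.sum_add_distrib],
      fun c x => by simp only [PiLp.smul_apply, smul_eq_mul, Finset.mul_sum]⟩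
  exact (cube_wellDefined d).2.2.inter (convex_halfSpace_ge hlin 1)

theorem simplex_subset_truncatedCube : simplex d ⊆ truncatedCube d := fun x hx =>
  ⟨fun i => ⟨hx.2 i, hx.1 ▸ Finset.single_le_sum (f := fun i => x i) (fun j _ => hx.2 j)
    (Finset.mem_univ i)⟩, hx.1.ge⟩

theorem add_le_sum_of_nonneg {x : EuclideanSpace ℝ (Fin d)} (hx : ∀ i, 0 ≤ x i) {i k : Fin d}
    (hik : i ≠ k) : x i + x k ≤ ∑ j, x j :=
  Finset.add_le_sum (f := fun j => x j) (fun j _ => hx j) (Finset.mem_univ i) (Finset.mem_univ k)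
    hik

theorem exists_mem_segment_mem_simplex {u y : EuclideanSpace ℝ (Fin d)} (hu : ∀ i, 0 ≤ u i)
    (hy : ∀ i, 0 ≤ y i) (husum : ∑ i, u i ≤ 1) (hysum : 1 ≤ ∑ i, y i) :
    ∃ p ∈ segment ℝ u y, p ∈ simplex d := by
  have hcont : Continuous fun x : EuclideanSpace ℝ (Fin d) => ∑ i, x i := by fun_prop
  obtain ⟨p, hp, hpsum⟩ := (convex_segment u y).isPreconnected.intermediate_value
    (left_mem_segment ℝ u y) (right_mem_segment ℝ u y) hcont.continuousOn ⟨husum, hysum⟩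
  refine ⟨p, hp, hpsum, fun i => ?_⟩
  obtain ⟨a, b, ha, hb, -, rfl⟩ := hp
  exact add_nonneg (mul_nonneg ha (hu i)) (mul_nonneg hb (hy i))

theorem isProj_truncatedCube_proj_simplex (hd : 0 < d) {w : EuclideanSpace ℝ (Fin d)}
    (hw : ∑ i, proj (cube d) w i ≤ 1) : IsProj (truncatedCube d) w (proj (simplex d) w) := by
  have hu := isProj_proj (cube_wellDefined d) w
  have hq := isProj_proj (simplex_wellDefined d hd) w
  refine ⟨simplex_subset_truncatedCube hq.1, fun y ⟨hy, hysum⟩ => ?_⟩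
  obtain ⟨p, hp, hpsimplex⟩ :=
    exists_mem_segment_mem_simplex (fun i => (hu.1 i).1) (fun i => (hy i).1) hw hysum
  have hball : p ∈ Metric.closedBall w ‖w - y‖ := by
    refine (convex_closedBall w _).segment_subset ?_ ?_ hp
    · rw [mem_closedBall_iff_norm']
      exact le_of_sq_le_sq (hu.2 y hy) (norm_nonneg _)
    · exact mem_closedBall_iff_norm'.2 le_rfl
  calc ‖w - proj (simplex d) w‖ ^ 2 ≤ ‖w - p‖ ^ 2 := hq.2 p hpsimplex
    _ ≤ ‖w - y‖ ^ 2 := by gcongr; exact mem_closedBall_iff_norm'.1 hball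

end TruncatedCube

section Facets

theorem parityPolytope_subset_preimage_flip {f : Fin d → Fin 2} (hf : Odd (weight f)) :
    parityPolytope d ⊆ flip f ⁻¹' truncatedCube d := by
  refine convexHull_min ?_ (convex_preimage_flip f (convex_truncatedCube d))
  rintro _ ⟨e, he, rfl⟩
  have hcube := flip_mem_cube f (binVec_mem_cube e)
  obtain ⟨i, hi⟩ := Function.ne_iff.1 fun h : e = f => Nat.not_even_iff_odd.2 hf (h ▸ he)
  refine ⟨hcube, ?_⟩
  calc 1 = flip f (binVec e) i := (flip_binVec_apply_of_ne hi).symm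
    _ ≤ ∑ j, flip f (binVec e) j :=
      Finset.single_le_sum (f := fun j => flip f (binVec e) j) (fun j _ => (hcube j).1)
        (Finset.mem_univ i)

theorem parityPolytope_subset_cube : parityPolytope d ⊆ cube d :=
  convexHull_min (Set.image_subset_iff.2 fun e _ => binVec_mem_cube e) (cube_wellDefined d).2.2

/-- The binary vector marking the positive entries of `c`. As a vertex of the cube it maximizes
the linear functional with coefficients `c`. -/
noncomputable def posIndicator (c : EuclideanSpace ℝ (Fin d)) : Fin d → Fin 2 :=
  fun i => if 0 < c i then 1 else 0

theorem inner_binVec_posIndicator_sub (c x : EuclideanSpace ℝ (Fin d)) :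
    inner ℝ c (binVec (posIndicator c) - x) = ∑ i, |c i| * flip (posIndicator c) x i := by
  rw [PiLp.inner_apply]
  refine Finset.sum_congr rfl fun i _ => ?_
  rw [PiLp.sub_apply, binVec_apply, flip_apply, posIndicator]
  by_cases h : 0 < c i
  · simp [h, abs_of_pos h, mul_comm]
  · simp [h, abs_of_nonpos (not_lt.1 h), mul_comm]

theorem inner_binVec_update_posIndicator (c : EuclideanSpace ℝ (Fin d)) (k : Fin d) :
    inner ℝ c (binVec (Function.update (posIndicator c) k (1 - posIndicator c k))) =
      inner ℝ c (binVec (posIndicator c)) - |c k| := by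
  rw [binVec_update, inner_add_right, EuclideanSpace.inner_single_right, binVec_apply, posIndicator]
  split_ifs with h
  · simp only [abs_of_pos h, Fin.val_one, Nat.cast_one, Real.ringHom_apply]
    ring
  · simp [abs_of_nonpos (not_lt.1 h)]

theorem exists_even_inner_le_inner_binVec {x : EuclideanSpace ℝ (Fin d)} (hx : x ∈ cube d)
    (hfacet : ∀ b, Odd (weight b) → 1 ≤ ∑ i, flip b x i) (c : EuclideanSpace ℝ (Fin d)) :
    ∃ e, Even (weight e) ∧ inner ℝ c x ≤ inner ℝ c (binVec e) := by
  set b := posIndicator c with hb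
  have hflip : ∀ i, 0 ≤ flip b x i := fun i => (flip_mem_cube b hx i).1
  have hgap : inner ℝ c (binVec b) - inner ℝ c x = ∑ i, |c i| * flip b x i := by
    rw [← inner_sub_right, inner_binVec_posIndicator_sub]
  rcases Nat.even_or_odd (weight b) with heven | hodd
  · refine ⟨b, heven, sub_nonneg.1 (hgap ▸ ?_)⟩
    exact Finset.sum_nonneg fun i _ => mul_nonneg (abs_nonneg _) (hflip i)
  · have : Nonempty (Fin d) := ⟨⟨0, pos_of_odd_weight hodd⟩⟩
    obtain ⟨k, hk⟩ := Finite.exists_min fun i => |c i|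
    have hcost : |c k| ≤ ∑ i, |c i| * flip b x i := calc
      |c k| ≤ |c k| * ∑ i, flip b x i := le_mul_of_one_le_right (abs_nonneg _) (hfacet b hodd)
      _ = ∑ i, |c k| * flip b x i := Finset.mul_sum _ _ _
      _ ≤ ∑ i, |c i| * flip b x i :=
        Finset.sum_le_sum fun i _ => mul_le_mul_of_nonneg_right (hk i) (hflip i)
    refine ⟨_, (even_weight_update b k).2 hodd, ?_⟩
    rw [inner_binVec_update_posIndicator, ← hb]
    linarith

/-- Jeroslow's facet description of the parity polytope. -/
theorem mem_parityPolytope_iff {x : EuclideanSpace ℝ (Fin d)} :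
    x ∈ parityPolytope d ↔ x ∈ cube d ∧ ∀ b, Odd (weight b) → 1 ≤ ∑ i, flip b x i := by
  refine ⟨fun hx => ⟨parityPolytope_subset_cube hx,
    fun b hb => (parityPolytope_subset_preimage_flip hb hx).2⟩, fun ⟨hx, hfacet⟩ => ?_⟩
  by_contra hnot
  obtain ⟨-, hclosed, hconvex⟩ := parityPolytope_wellDefined d
  obtain ⟨L, r, hL, hr⟩ := geometric_hahn_banach_closed_point hconvex hclosed hnot
  obtain ⟨e, he, hle⟩ :=
    exists_even_inner_le_inner_binVec hx hfacet ((InnerProductSpace.toDual ℝ _).symm L)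
  rw [InnerProductSpace.toDual_symm_apply, InnerProductSpace.toDual_symm_apply] at hle
  exact absurd hle (not_le.2 ((hL _ (subset_convexHull ℝ _ ⟨e, he, rfl⟩)).trans hr))

variable {f : Fin d → Fin 2}

theorem one_le_sum_flip_of_ne {g : Fin d → Fin 2} (hf : Odd (weight f)) (hg : Odd (weight g))
    (hgf : g ≠ f) {x : EuclideanSpace ℝ (Fin d)} (hx : x ∈ cube d)
    (hpair : ∀ i k, i ≠ k → flip f x i + flip f x k ≤ 1) : 1 ≤ ∑ i, flip g x i := by
  have hparity : Even (weight g) ↔ Even (weight f) :=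
    iff_of_false (Nat.not_even_iff_odd.2 hg) (Nat.not_even_iff_odd.2 hf)
  obtain ⟨i, k, hik, hi, hk⟩ := exists_two_ne_of_even_iff hparity hgf
  calc 1 ≤ (1 - flip f x i) + (1 - flip f x k) := by linarith [hpair i k hik]
    _ = flip g x i + flip g x k := by rw [flip_apply_of_ne hi, flip_apply_of_ne hk]
    _ ≤ ∑ j, flip g x j := add_le_sum_of_nonneg (fun j => (flip_mem_cube g hx j).1) hik

theorem mem_parityPolytope_iff_one_le_sum_flip (hf : Odd (weight f))
    {x : EuclideanSpace ℝ (Fin d)} (hx : x ∈ cube d)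
    (hpair : ∀ i k, i ≠ k → flip f x i + flip f x k ≤ 1) :
    x ∈ parityPolytope d ↔ 1 ≤ ∑ i, flip f x i := by
  rw [mem_parityPolytope_iff]
  refine ⟨fun h => h.2 f hf, fun hsum => ⟨hx, fun g hg => ?_⟩⟩
  rcases eq_or_ne g f with rfl | hgf
  · exact hsum
  · exact one_le_sum_flip_of_ne hf hg hgf hx hpair

theorem flip_mem_parityPolytope_of_mem_simplex (hf : Odd (weight f))
    {q : EuclideanSpace ℝ (Fin d)} (hq : q ∈ simplex d) : flip f q ∈ parityPolytope d := by
  obtain ⟨hcube, hsum⟩ := simplex_subset_truncatedCube hq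
  refine (mem_parityPolytope_iff_one_le_sum_flip hf (flip_mem_cube f hcube) ?_).2 ?_
  · simp only [flip_flip]
    exact fun i k hik => hq.1 ▸ add_le_sum_of_nonneg hq.2 hik
  · rwa [flip_flip]

theorem proj_parityPolytope_of_proj_cube_mem {v : EuclideanSpace ℝ (Fin d)}
    (h : proj (cube d) v ∈ parityPolytope d) : proj (parityPolytope d) v = proj (cube d) v :=
  ((isProj_proj (cube_wellDefined d) v).mono parityPolytope_subset_cube h).proj_eq
    (parityPolytope_wellDefined d)

theorem proj_parityPolytope_of_sum_le_one (hf : Odd (weight f)) {v : EuclideanSpace ℝ (Fin d)}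
    (hsum : ∑ i, proj (cube d) (flip f v) i ≤ 1) :
    proj (parityPolytope d) v = flip f (proj (simplex d) (flip f v)) := by
  have hd := pos_of_odd_weight hf
  have hmem := flip_mem_parityPolytope_of_mem_simplex hf
    (isProj_proj (simplex_wellDefined d hd) (flip f v)).1
  have h := (isProj_truncatedCube_proj_simplex hd hsum).preimage_flip f
  rw [flip_flip] at h
  exact (h.mono (parityPolytope_subset_preimage_flip hf) hmem).proj_eq
    (parityPolytope_wellDefined d)

end Facets

section FacetVector

theorem flip_threshold_apply (x : EuclideanSpace ℝ (Fin d)) (i : Fin d) :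
    flip (threshold x) x i = 1 / 2 - |1 / 2 - x i| := by
  rw [flip_apply, threshold]
  split_ifs with hi h h
  · rw [abs_of_neg (by linarith)]
    ring
  · exact absurd rfl h
  · exact absurd h (by decide)
  · rw [abs_of_nonneg (by linarith)]
    ring

variable {v : EuclideanSpace ℝ (Fin d)} {f : Fin d → Fin 2}

theorem flip_update_threshold_add_le_one {x : EuclideanSpace ℝ (Fin d)} {j : Fin d}
    (hj : ∀ i, |1 / 2 - x j| ≤ |1 / 2 - x i|) {i k : Fin d} (hik : i ≠ k) :
    flip (Function.update (threshold x) j (1 - threshold x j)) x i +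
      flip (Function.update (threshold x) j (1 - threshold x j)) x k ≤ 1 := by
  set g := Function.update (threshold x) j (1 - threshold x j) with hg
  have hne : ∀ l, l ≠ j → flip g x l ≤ 1 / 2 - |1 / 2 - x j| := by
    intro l hl
    rw [flip_apply_of_eq (Function.update_of_ne hl _ _), flip_threshold_apply]
    linarith [hj l]
  have hself : flip g x j = 1 / 2 + |1 / 2 - x j| := by
    have : g j ≠ threshold x j := by
      rw [hg, Function.update_self]
      generalize threshold x j = s
      revert s
      decide
    rw [flip_apply_of_ne this, flip_threshold_apply]
    ring
  have hle : ∀ l, flip g x l ≤ 1 / 2 + |1 / 2 - x j| := by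
    intro l
    rcases eq_or_ne l j with rfl | hl
    · exact hself.le
    · linarith [hne l hl, abs_nonneg (1 / 2 - x j)]
  rcases eq_or_ne i j with rfl | hi
  · linarith [hle i, hne k hik.symm]
  · linarith [hne i hi, hle k]

theorem IsFacetVector.odd_weight (hf : IsFacetVector v f) : Odd (weight f) := by
  rcases hf with ⟨hodd, rfl⟩ | ⟨heven, j, -, rfl⟩
  · exact hodd
  · rwa [← Nat.not_even_iff_odd, even_weight_update, Nat.not_odd_iff_even]

theorem IsFacetVector.flip_add_flip_le_one (hf : IsFacetVector v f) {i k : Fin d} (hik : i ≠ k) :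
    flip f (proj (cube d) v) i + flip f (proj (cube d) v) k ≤ 1 := by
  rcases hf with ⟨-, rfl⟩ | ⟨-, j, hj, rfl⟩
  · rw [flip_threshold_apply, flip_threshold_apply]
    linarith [abs_nonneg (1 / 2 - proj (cube d) v i), abs_nonneg (1 / 2 - proj (cube d) v k)]
  · exact flip_update_threshold_add_le_one hj hik

theorem IsFacetVector.proj_cube_mem_parityPolytope_iff (hf : IsFacetVector v f) :
    proj (cube d) v ∈ parityPolytope d ↔ 1 ≤ ∑ i, proj (cube d) (flip f v) i := by
  rw [proj_cube_flip]
  exact mem_parityPolytope_iff_one_le_sum_flip hf.odd_weight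
    (isProj_proj (cube_wellDefined d) v).1 fun _ _ => hf.flip_add_flip_le_one

end FacetVector

end ParityPolytope

open ParityPolytope in
theorem theorem2_general (d : ℕ) (v : EuclideanSpace ℝ (Fin d)) (f : Fin d → Fin 2)
    (hf : IsFacetVector v f) :
    (proj (cube d) v ∉ parityPolytope d →
      proj (parityPolytope d) v =
        ParityPolytope.flip f (proj (simplex d) (ParityPolytope.flip f v))) ∧
      algorithmOutput v f = proj (parityPolytope d) v := by
  have hsimplex : proj (cube d) v ∉ parityPolytope d →
      proj (parityPolytope d) v =
        ParityPolytope.flip f (proj (simplex d) (ParityPolytope.flip f v)) := by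
    rw [hf.proj_cube_mem_parityPolytope_iff, not_le]
    exact fun hlt => proj_parityPolytope_of_sum_le_one hf.odd_weight hlt.le
  refine ⟨hsimplex, ?_⟩
  rw [algorithmOutput]
  split_ifs with hsum <;> rw [← hf.proj_cube_mem_parityPolytope_iff] at hsum
  · exact (proj_parityPolytope_of_proj_cube_mem hsum).symm
  · exact (hsimplex hsum).symm

theorem theorem2 (d : ℕ) (v : EuclideanSpace ℝ (Fin d)) (f : Fin d → Fin 2)
    (hv : ParityPolytope.proj (ParityPolytope.cube d) v ∉ ParityPolytope.parityPolytope d)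
    (hf : ParityPolytope.IsFacetVector v f) :
    ParityPolytope.proj (ParityPolytope.parityPolytope d) v =
        ParityPolytope.flip f
          (ParityPolytope.proj (ParityPolytope.simplex d) (ParityPolytope.flip f v)) ∧
      ParityPolytope.algorithmOutput v f =
        ParityPolytope.proj (ParityPolytope.parityPolytope d) v :=
  (theorem2_general d v f hf).imp_left fun hsimplex => hsimplex hv
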